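/- Let $M\ge 1$ receivers and $N\ge 1$ transmitters be connected by a channel matrix $\mathbf H=(h_{ij})\in\mathbb R_{+}^{M\times N}$ with independent log-normal entries, $\ln h_{ij}\sim\mathcal N(\mu_{ij},\sigma_{ij}^2)$, $\sigma_{ij}>0$, and let $\mathbf h_i^T$ be its $i$-th row. A space code is given by a finite constellation $\mathcal B\subset\mathbb R$ and encoders $\mathbf F_\ell:\mathcal B\to\mathbb R^N$, $\ell=1,\dots,L$; its codewords are $\mathbf x(\mathbf s)=\sum_{\ell=1}^L\mathbf F_\ell(s_\ell)$, $\mathbf s\in\mathcal B^L$. Assume that its average optical power $P_{op}=|\mathcal B|^{-L}\sum_{\mathbf s\in\mathcal B^L}\sum_{n=1}^N x_n(\mathbf s)$ is positive (this is automatic if all codewords have nonnegative entries and at least two codewords are distinct). Let $\mathcal E$ be the set of all nonzero differences of two codewords. For $\mathbf e\in\mathcal E$ and squared optical signal-to-noise ratio $\rho>0$, the pairwise error probability of the maximum likelihood receiver is $$P_{\mathbf e}(\rho)=\mathbb E_{\mathbf H}\!\left[Q\!\left(\frac{d(\mathbf e)}{2}\right)\right],\qquad d^2(\mathbf e)=\frac{\rho}{N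 P_{op}^2}\sum_{i=1}^M\left(\mathbf h_i^T\mathbf e\right)^2,\qquad Q(x)=\frac1{\sqrt{2\pi}}\int_x^\infty e^{-t^2/2}\,dt .$$ Say that $P_{\mathbf e}$ has large-scale diversity gain $D$ if $$\ln P_{\mathbf e}(\rho)=-\left(\frac{D}{8}+o(1)\right)\ln^2\frac{\rho}{\ln^2\rho}\qquad(\rho\to\infty),$$ and that the code enables full large-scale diversity if $P_{\mathbf e}$ has large-scale diversity gain $\Omega=\sum_{i=1}^M\sum_{j=1}^N\sigma_{ij}^{-2}$ for every $\mathbf e\in\mathcal E$. Theorem. The space code enables full large-scale diversity if and only if every $\mathbf e\in\mathcal E$ is unipolar (its entries do not include two of opposite signs) and has no zero entry; equivalently, if and only if for every $\mathbf e\in\mathcal E$ all entries of the matrix $\mathbf e\mathbf e^T$ are positive. -/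

import Mathlib

namespace MimoOwc

/-- The Gaussian tail function `Q(x) = P(Z > x)`, where `Z` is a standard normal variable. -/
noncomputable def gaussianQ (x : ℝ) : ℝ :=
  (ProbabilityTheory.gaussianReal 0 1).real (Set.Ioi x)

/-- The log-normal law: the law of `exp z` where `z` is normal with mean `m` and variance `s ^ 2`. -/
noncomputable def logNormal (m s : ℝ) : MeasureTheory.Measure ℝ :=
  (ProbabilityTheory.gaussianReal m (Real.toNNReal (s ^ 2))).map Real.exp

/-- The law of the `M × N` channel matrix `(h i j)`: independent log-normal entries, where
`ln (h i j)` has mean `m i j` and variance `σ i j ^ 2`. Rows are receivers, columns transmitters. -/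
noncomputable def channelLaw {M N : ℕ} (m σ : Fin M → Fin N → ℝ) :
    MeasureTheory.Measure (Fin M → Fin N → ℝ) :=
  MeasureTheory.Measure.pi fun i => MeasureTheory.Measure.pi fun j => logNormal (m i j) (σ i j)

/-- A space code: a finite constellation, from which the `L` symbols are drawn, and for every
symbol an encoder mapping it to a vector indexed by the `N` transmitters. -/
structure SpaceCode (L N : ℕ) where
  constellation : Finset ℝ
  encoder : Fin L → ℝ → Fin N → ℝ

namespace SpaceCode

variable {L N : ℕ}

/-- The set of the symbol vectors that may be transmitted. -/
def symbols (C : SpaceCode L N) : Finset (Fin L → ℝ) :=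
  Fintype.piFinset fun _ => C.constellation

/-- The codeword of a symbol vector: the sum of the vectors encoding the single symbols. -/
def codeword (C : SpaceCode L N) (s : Fin L → ℝ) : Fin N → ℝ :=
  ∑ l, C.encoder l (s l)

/-- The average optical power: the mean of the sum of the entries of the codeword, for symbols
chosen independently and uniformly from the constellation. -/
noncomputable def opticalPower (C : SpaceCode L N) : ℝ :=
  (∑ s ∈ C.symbols, ∑ n, C.codeword s n) / (C.symbols.card : ℝ)

/-- The error set: the nonzero differences of two codewords. -/
def errorSet (C : SpaceCode L N) : Set (Fin N → ℝ) :=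
  {e | e ≠ 0 ∧ ∃ s ∈ C.symbols, ∃ t ∈ C.symbols, e = C.codeword s - C.codeword t}

end SpaceCode

/-- The received distance `d(e)`, given by `d(e)² = ρ / (N P²) * ∑ᵢ (hᵢᵀ e)²`, for the channel
matrix `h` with rows `hᵢ`, squared optical signal-to-noise ratio `ρ` and optical power `P`. -/
noncomputable def distance {M N : ℕ} (P ρ : ℝ) (e : Fin N → ℝ) (h : Fin M → Fin N → ℝ) : ℝ :=
  Real.sqrt (ρ / ((N : ℝ) * P ^ 2) * ∑ i, (h i ⬝ᵥ e) ^ 2)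

/-- The pairwise error probability of the maximum likelihood receiver for two codewords with
difference `e`: the conditional probability `Q(d(e)/2)` given the channel, averaged over the
channel. -/
noncomputable def pep {M N : ℕ} (m σ : Fin M → Fin N → ℝ) (P : ℝ) (e : Fin N → ℝ) (ρ : ℝ) : ℝ :=
  ∫ h, gaussianQ (distance P ρ e h / 2) ∂(channelLaw m σ)

/-- An error probability `p`, as a function of the squared optical signal-to-noise ratio `ρ`, has
large-scale diversity gain `D` if it decays like `exp (-(D / 8) * ln² (ρ / ln² ρ))` in the
exponent, that is, `ln (p ρ) = -(D / 8 + o(1)) * ln² (ρ / ln² ρ)` as `ρ → ∞`. -/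
def HasLargeScaleDiversityGain (p : ℝ → ℝ) (D : ℝ) : Prop :=
  Filter.Tendsto (fun ρ : ℝ => -8 * Real.log (p ρ) / Real.log (ρ / Real.log ρ ^ 2) ^ 2)
    Filter.atTop (nhds D)

/-- The full large-scale diversity gain `Ω = ∑ᵢⱼ σᵢⱼ⁻²`. -/
noncomputable def fullGain {M N : ℕ} (σ : Fin M → Fin N → ℝ) : ℝ :=
  ∑ i, ∑ j, (σ i j ^ 2)⁻¹

/-- A space code enables full large-scale diversity if all of its pairwise error probabilities
have the large-scale diversity gain `Ω`. -/
def EnablesFullLargeScaleDiversity {M N L : ℕ} (m σ : Fin M → Fin N → ℝ)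
    (C : SpaceCode L N) : Prop :=
  ∀ e ∈ C.errorSet, HasLargeScaleDiversityGain (pep m σ C.opticalPower e) (fullGain σ)

/-- A vector is unipolar if it does not have entries of opposite signs. -/
def IsUnipolar {N : ℕ} (e : Fin N → ℝ) : Prop :=
  (∀ j, 0 ≤ e j) ∨ (∀ j, e j ≤ 0)

end MimoOwc

/-!
Put `x = ln ρ`. Since `ln (ρ / ln² ρ) ~ x`, a gain `D` means decay like `exp (-(D / 8) * x ^ 2)`.
A log-normal entry lies within `exp (-x / 2)` of `0` with probability about
`exp (-x ^ 2 / (8 * σ ^ 2))`, whereas lying that close to a positive number costs nothing on this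
scale.

Let `p ≥ 0` be orthogonal to `e`. If all rows of the channel are within `exp (-x / 2)` of `p`, then
`d(e)` stays bounded, so the gain is at most the sum of `σᵢⱼ⁻²` over the `j` with `p j = 0`. For
unipolar `e`, no entries of `hᵢᵀ e` cancel: unless all `hᵢⱼ` with `e j ≠ 0` are at most
`x ^ 2 * exp (-x / 2)`, the error probability is at most `exp (-κ * x ^ 4)`. Taking for `p` the
indicator of the zeros of `e`, the two bounds match, and the gain is the sum of `σᵢⱼ⁻²` over the
`j` with `e j ≠ 0`. If `e` is not unipolar, then `p` can be chosen positive in all entries, and the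
gain is `0`.
-/

namespace MimoOwc

open MeasureTheory ProbabilityTheory Filter Topology Set

section DecayRate

/-- The function `p` has the decay rate `c` if `p x = exp (-(c + o(1)) * x ^ 2)` as `x → ∞`. The
variable `x` stands for `ln ρ`. -/
structure HasDecayRate (p : ℝ → ℝ) (c : ℝ) : Prop where
  eventually_pos : ∀ᶠ x in atTop, 0 < p x
  tendsto : Tendsto (fun x => -Real.log (p x) / x ^ 2) atTop (𝓝 c)

variable {p q r g : ℝ → ℝ} {a b c : ℝ}

theorem hasDecayRate_exp_neg (hg : Tendsto (fun x => g x / x ^ 2) atTop (𝓝 c)) :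
    HasDecayRate (fun x => Real.exp (-g x)) c where
  eventually_pos := .of_forall fun _ => Real.exp_pos _
  tendsto := by simpa only [Real.log_exp, neg_neg] using hg

theorem hasDecayRate_const (ha : 0 < a) : HasDecayRate (fun _ => a) 0 where
  eventually_pos := .of_forall fun _ => ha
  tendsto := tendsto_const_nhds.div_atTop (tendsto_pow_atTop two_ne_zero)

theorem hasDecayRate_zero_of_tendsto_log_div (hpos : ∀ᶠ x in atTop, 0 < p x)
    (hlog : Tendsto (fun x => Real.log (p x) / x) atTop (𝓝 a)) : HasDecayRate p 0 where
  eventually_pos := hpos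
  tendsto := (hlog.neg.div_atTop tendsto_id).congr fun x => by
    rw [id, ← neg_div, div_div, ← sq]

namespace HasDecayRate

theorem mul (hp : HasDecayRate p a) (hq : HasDecayRate q b) :
    HasDecayRate (fun x => p x * q x) (a + b) where
  eventually_pos := hp.eventually_pos.and hq.eventually_pos |>.mono fun _ h => mul_pos h.1 h.2
  tendsto := (hp.tendsto.add hq.tendsto).congr' <| by
    filter_upwards [hp.eventually_pos, hq.eventually_pos] with x hpx hqx
    rw [Real.log_mul hpx.ne' hqx.ne']
    ring

theorem inv (hp : HasDecayRate p a) : HasDecayRate (fun x => (p x)⁻¹) (-a) where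
  eventually_pos := hp.eventually_pos.mono fun _ => inv_pos.2
  tendsto := by simpa only [Real.log_inv, neg_div] using hp.tendsto.neg

theorem prod {ι : Type*} {s : Finset ι} {p : ι → ℝ → ℝ} {a : ι → ℝ}
    (hp : ∀ i ∈ s, HasDecayRate (p i) (a i)) :
    HasDecayRate (fun x => ∏ i ∈ s, p i x) (∑ i ∈ s, a i) := by
  induction s using Finset.cons_induction with
  | empty => simpa only [Finset.prod_empty, Finset.sum_empty] using hasDecayRate_const one_pos
  | cons i s hi ih =>
    simp only [Finset.prod_cons, Finset.sum_cons]
    exact (hp i (Finset.mem_cons_self i s)).mul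
      (ih fun j hj => hp j (Finset.mem_cons_of_mem hj))

theorem squeeze (hp : HasDecayRate p c) (hr : HasDecayRate r c)
    (hpq : ∀ᶠ x in atTop, p x ≤ q x) (hqr : ∀ᶠ x in atTop, q x ≤ r x) : HasDecayRate q c where
  eventually_pos := hp.eventually_pos.and hpq |>.mono fun _ h => h.1.trans_le h.2
  tendsto := by
    refine tendsto_of_tendsto_of_tendsto_of_le_of_le' hr.tendsto hp.tendsto ?_ ?_
    · filter_upwards [hp.eventually_pos, hpq, hqr] with x hpx hpq hqr
      gcongr
      exact hpx.trans_le hpq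
    · filter_upwards [hp.eventually_pos, hpq] with x hpx hpq
      gcongr

theorem eventually_exp_neg_le (hp : HasDecayRate p c)
    (hg : Tendsto (fun x => g x / x ^ 2) atTop atTop) : ∀ᶠ x in atTop, Real.exp (-g x) ≤ p x := by
  filter_upwards [hp.eventually_pos, hp.tendsto.eventually_le_const (lt_add_one c),
    hg.eventually_ge_atTop (c + 1), eventually_gt_atTop 0] with x hpx hle hge hx
  have hlog : -Real.log (p x) ≤ g x :=
    (div_le_div_iff_of_pos_right (by positivity)).1 (hle.trans hge)
  exact (Real.le_log_iff_exp_le hpx).1 (neg_le.1 hlog)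

theorem add_exp_neg (hp : HasDecayRate p c) (hg : Tendsto (fun x => g x / x ^ 2) atTop atTop) :
    HasDecayRate (fun x => p x + Real.exp (-g x)) c := by
  have htwo : HasDecayRate (fun x => 2 * p x) c := by
    simpa only [zero_add] using (hasDecayRate_const two_pos).mul hp
  refine hp.squeeze htwo (.of_forall fun x => le_add_of_nonneg_right (Real.exp_pos _).le) ?_
  filter_upwards [hp.eventually_exp_neg_le hg] with x hx
  linarith

end HasDecayRate

theorem tendsto_log_div_self : Tendsto (fun x : ℝ => Real.log x / x) atTop (𝓝 0) :=
  Real.isLittleO_log_id_atTop.tendsto_div_nhds_zero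

theorem tendsto_log_div_log_sq_div_log :
    Tendsto (fun ρ : ℝ => Real.log (ρ / Real.log ρ ^ 2) / Real.log ρ) atTop (𝓝 1) := by
  have hlim : Tendsto (fun ρ : ℝ => 1 - 2 * (Real.log (Real.log ρ) / Real.log ρ)) atTop (𝓝 1) := by
    simpa using ((tendsto_log_div_self.comp Real.tendsto_log_atTop).const_mul 2).const_sub 1
  refine hlim.congr' ?_
  filter_upwards [eventually_gt_atTop 1] with ρ hρ
  have hlog : 0 < Real.log ρ := Real.log_pos hρ
  rw [Real.log_div (by positivity) (by positivity), Real.log_pow]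
  push_cast
  field

theorem HasDecayRate.hasLargeScaleDiversityGain {D : ℝ}
    (hp : HasDecayRate (fun x => p (Real.exp x)) (D / 8)) : HasLargeScaleDiversityGain p D := by
  have hlim := ((hp.tendsto.comp Real.tendsto_log_atTop).const_mul 8).div
    (tendsto_log_div_log_sq_div_log.pow 2) (by norm_num)
  rw [one_pow, div_one, mul_div_cancel₀ D (by norm_num)] at hlim
  refine hlim.congr' ?_
  filter_upwards [eventually_gt_atTop 1] with ρ hρ
  have hlog : 0 < Real.log ρ := Real.log_pos hρ
  simp only [Pi.div_apply, Function.comp_apply, Real.exp_log (one_pos.trans hρ), div_pow]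
  rw [mul_div_assoc', div_div_div_cancel_right₀ (by positivity)]
  ring

end DecayRate

section Gaussian

theorem hasSubgaussianMGF_id_gaussianReal (v : NNReal) :
    HasSubgaussianMGF id v (gaussianReal 0 v) where
  integrable_exp_mul _ := integrable_exp_mul_gaussianReal _
  mgf_le t := by simp [mgf_id_gaussianReal]

theorem hasSubgaussianMGF_const_sub_gaussianReal (m : ℝ) (v : NNReal) :
    HasSubgaussianMGF (fun y => m - y) v (gaussianReal m v) := by
  rw [← HasSubgaussianMGF.id_map_iff (by fun_prop), gaussianReal_map_const_sub, sub_self]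
  exact hasSubgaussianMGF_id_gaussianReal v

theorem gaussianReal_real_Iic_le (m : ℝ) (v : NNReal) (x : ℝ) :
    (gaussianReal m v).real (Iic x) ≤ Real.exp (-(max (m - x) 0 ^ 2 / (2 * v))) := by
  rcases le_total x m with hx | hx
  · rw [max_eq_left (sub_nonneg.2 hx), ← neg_div]
    refine le_trans (measureReal_mono fun y hy => ?_)
      ((hasSubgaussianMGF_const_sub_gaussianReal m v).measure_ge_le (sub_nonneg.2 hx))
    exact sub_le_sub_left (mem_Iic.1 hy) m
  · simp [max_eq_right (sub_nonpos.2 hx)]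

theorem le_gaussianReal_real_Ioc (m : ℝ) {v : NNReal} (hv : v ≠ 0) (u : ℝ) {w : ℝ} (hw0 : 0 ≤ w)
    (hw1 : w ≤ 1) :
    w * ((√(2 * Real.pi * v))⁻¹ * Real.exp (-((|m - u| + 1) ^ 2 / (2 * v)))) ≤
      (gaussianReal m v).real (Ioc (u - w) u) := by
  have hpdf : ∀ y ∈ Ioc (u - w) u, (√(2 * Real.pi * v))⁻¹ *
      Real.exp (-((|m - u| + 1) ^ 2 / (2 * v))) ≤ gaussianPDFReal m v y := by
    rintro y ⟨hlt, hle⟩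
    have hdist : |m - y| ≤ |m - u| + 1 := (abs_sub_le m u y).trans <|
      add_le_add_right (abs_le.2 ⟨by linarith, by linarith⟩) _
    have hsq : (y - m) ^ 2 ≤ (|m - u| + 1) ^ 2 :=
      sq_le_sq.2 (by simpa only [abs_sub_comm y m] using hdist.trans (le_abs_self _))
    rw [gaussianPDFReal, neg_div]
    gcongr
  have hint := setIntegral_mono_on (integrableOn_const (by simp))
    (integrable_gaussianPDFReal m v).integrableOn measurableSet_Ioc hpdf
  rw [Measure.real, gaussianReal_apply_eq_integral m hv, ENNReal.toReal_ofReal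
    (integral_nonneg fun _ => gaussianPDFReal_nonneg _ _ _)]
  simpa [hw0] using hint

theorem hasDecayRate_gaussianReal (m : ℝ) {v : NNReal} (hv : v ≠ 0) {u w : ℝ → ℝ}
    {S : ℝ → Set ℝ} {α : ℝ} (hα : 0 ≤ α) (hu : Tendsto (fun x => u x / x) atTop (𝓝 (-α)))
    (hw : HasDecayRate w 0) (hw_le : ∀ᶠ x in atTop, w x ≤ 1)
    (hIoc : ∀ᶠ x in atTop, Ioc (u x - w x) (u x) ⊆ S x) (hIic : ∀ᶠ x in atTop, S x ⊆ Iic (u x)) :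
    HasDecayRate (fun x => (gaussianReal m v).real (S x)) (α ^ 2 / (2 * v)) := by
  have hsub : Tendsto (fun x => (m - u x) / x) atTop (𝓝 α) := by
    simpa only [sub_div, zero_sub, neg_neg, id] using
      ((tendsto_const_nhds (x := m)).div_atTop tendsto_id).sub hu
  have hradius : Tendsto (fun x => (|m - u x| + 1) / x) atTop (𝓝 α) := by
    have hlim := hsub.abs.add ((tendsto_const_nhds (x := (1 : ℝ))).div_atTop tendsto_id)
    rw [abs_of_nonneg hα, add_zero] at hlim
    refine hlim.congr' ?_
    filter_upwards [eventually_gt_atTop 0] with x hx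
    rw [abs_div, abs_of_pos hx, id, add_div]
  have hmax : Tendsto (fun x => max (m - u x) 0 / x) atTop (𝓝 α) := by
    have hlim := hsub.max (tendsto_const_nhds (x := (0 : ℝ)))
    rw [max_eq_left hα] at hlim
    refine hlim.congr' ?_
    filter_upwards [eventually_gt_atTop 0] with x hx
    rw [← max_div_div_right hx.le, zero_div]
  have hrate : ∀ {y : ℝ → ℝ}, Tendsto (fun x => y x / x) atTop (𝓝 α) →
      HasDecayRate (fun x => Real.exp (-(y x ^ 2 / (2 * v)))) (α ^ 2 / (2 * v)) := fun hy =>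
    hasDecayRate_exp_neg (((hy.pow 2).div_const (2 * v)).congr fun x => by ring)
  have hlower := hw.mul
    ((hasDecayRate_const (a := (√(2 * Real.pi * v))⁻¹) (by positivity)).mul (hrate hradius))
  rw [zero_add, zero_add] at hlower
  refine hlower.squeeze (hrate hmax) ?_ ?_
  · filter_upwards [hw.eventually_pos, hw_le, hIoc] with x hw0 hw1 hS
    exact (le_gaussianReal_real_Ioc m hv (u x) hw0.le hw1).trans (measureReal_mono hS)
  · filter_upwards [hIic] with x hS
    exact (measureReal_mono hS).trans (gaussianReal_real_Iic_le m v (u x))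

theorem gaussianQ_le {x : ℝ} (hx : 0 ≤ x) : gaussianQ x ≤ Real.exp (-(x ^ 2 / 2)) := by
  have hle := (hasSubgaussianMGF_id_gaussianReal 1).measure_ge_le hx
  rw [NNReal.coe_one, mul_one, neg_div] at hle
  exact (measureReal_mono Ioi_subset_Ici_self).trans hle

theorem gaussianQ_pos (x : ℝ) : 0 < gaussianQ x := by
  refine measureReal_nonneg.lt_of_ne' fun h => ?_
  have hnull : volume (Ioi x) = 0 :=
    gaussianReal_absolutelyContinuous' 0 one_ne_zero ((measureReal_eq_zero_iff (by simp)).1 h)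
  simp at hnull

theorem gaussianQ_antitone : Antitone gaussianQ := fun _ _ h =>
  measureReal_mono (Ioi_subset_Ioi h)

theorem gaussianQ_le_one (x : ℝ) : gaussianQ x ≤ 1 := measureReal_le_one

end Gaussian

section LogNormal

instance isProbabilityMeasure_logNormal (m s : ℝ) : IsProbabilityMeasure (logNormal m s) :=
  Measure.isProbabilityMeasure_map Real.measurable_exp.aemeasurable

theorem ae_logNormal_pos (m s : ℝ) : ∀ᵐ x ∂logNormal m s, 0 < x := by
  rw [logNormal, ae_map_iff Real.measurable_exp.aemeasurable measurableSet_Ioi]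
  exact ae_of_all _ Real.exp_pos

theorem Ioc_log_subset_preimage_exp {p t : ℝ} (hp : 0 ≤ p) (ht : 0 < t) :
    Ioc (Real.log (p + t) - t / (p + t)) (Real.log (p + t)) ⊆ Real.exp ⁻¹' Ioc p (p + t) := by
  have hpt : 0 < p + t := by positivity
  rintro y ⟨hlt, hle⟩
  refine ⟨?_, (Real.le_log_iff_exp_le hpt).1 hle⟩
  calc p = (p + t) * (-(t / (p + t)) + 1) := by field
    _ ≤ (p + t) * Real.exp (-(t / (p + t))) := by
      gcongr
      exact Real.add_one_le_exp _
    _ = Real.exp (Real.log (p + t) - t / (p + t)) := by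
      rw [sub_eq_add_neg, Real.exp_add, Real.exp_log hpt]
    _ < Real.exp y := Real.exp_lt_exp.2 hlt

theorem hasDecayRate_logNormal (m : ℝ) {s : ℝ} (hs : s ≠ 0) {p : ℝ} (hp : 0 ≤ p) {t : ℝ → ℝ}
    {S : ℝ → Set ℝ} {α : ℝ} (hα : 0 ≤ α) (ht : HasDecayRate t 0)
    (hlog : Tendsto (fun x => Real.log (p + t x) / x) atTop (𝓝 (-α)))
    (hS : ∀ x, MeasurableSet (S x)) (hIoc : ∀ x, Ioc p (p + t x) ⊆ S x)
    (hIic : ∀ x, S x ⊆ Iic (p + t x)) :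
    HasDecayRate (fun x => (logNormal m s).real (S x)) (α ^ 2 / (2 * s ^ 2)) := by
  have hpt : ∀ᶠ x in atTop, 0 < p + t x := ht.eventually_pos.mono fun x hx => by positivity
  have hwidth := ht.mul (hasDecayRate_zero_of_tendsto_log_div hpt hlog).inv
  rw [neg_zero, add_zero] at hwidth
  have hrate := hasDecayRate_gaussianReal m (v := Real.toNNReal (s ^ 2)) (by simpa using hs) hα
    hlog hwidth (S := fun x => Real.exp ⁻¹' S x) ?_ ?_ ?_
  · simpa only [logNormal, map_measureReal_apply Real.measurable_exp (hS _),
      Real.coe_toNNReal _ (sq_nonneg s)] using hrate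
  · filter_upwards [hpt] with x hx
    rw [← div_eq_mul_inv, div_le_one hx]
    exact le_add_of_nonneg_left hp
  · filter_upwards [ht.eventually_pos] with x hx
    exact (Ioc_log_subset_preimage_exp hp hx).trans (preimage_mono (hIoc x))
  · filter_upwards [hpt] with x hx y hy
    exact (Real.le_log_iff_exp_le hx).2 (hIic x hy)

theorem hasDecayRate_logNormal_Iic (m : ℝ) {s : ℝ} (hs : s ≠ 0) :
    HasDecayRate (fun x => (logNormal m s).real (Iic (x ^ 2 * Real.exp (-x / 2))))
      ((s ^ 2)⁻¹ / 8) := by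
  have hpos : ∀ᶠ x : ℝ in atTop, 0 < x ^ 2 * Real.exp (-x / 2) := by
    filter_upwards [eventually_gt_atTop 0] with x hx
    positivity
  have hlog : Tendsto (fun x => Real.log (x ^ 2 * Real.exp (-x / 2)) / x) atTop
      (𝓝 (-(1 / 2))) := by
    have hlim := (tendsto_log_div_self.const_mul 2).sub_const (1 / 2)
    rw [mul_zero, zero_sub] at hlim
    refine hlim.congr' ?_
    filter_upwards [eventually_gt_atTop 0] with x hx
    rw [Real.log_mul (by positivity) (Real.exp_ne_zero _), Real.log_exp, Real.log_pow]
    push_cast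
    field
  convert hasDecayRate_logNormal m hs le_rfl one_half_pos.le
    (hasDecayRate_zero_of_tendsto_log_div hpos hlog) (by simpa only [zero_add] using hlog)
    (fun _ => measurableSet_Iic) (fun x => ?_) (fun x => ?_) using 1
  · ring
  · rw [zero_add]
    exact Ioc_subset_Iic_self
  · rw [zero_add]

theorem hasDecayRate_logNormal_Ioc (m : ℝ) {s p : ℝ} (hs : s ≠ 0) (hp : 0 ≤ p) :
    HasDecayRate (fun x => (logNormal m s).real (Ioc p (p + Real.exp (-x / 2))))
      (if p = 0 then (s ^ 2)⁻¹ / 8 else 0) := by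
  have hlog_exp : Tendsto (fun x : ℝ => Real.log (Real.exp (-x / 2)) / x) atTop
      (𝓝 (-(1 / 2))) := by
    refine tendsto_const_nhds.congr' ?_
    filter_upwards [eventually_gt_atTop 0] with x hx
    rw [Real.log_exp]
    field
  have hrate := hasDecayRate_zero_of_tendsto_log_div (.of_forall fun _ => Real.exp_pos _) hlog_exp
  rcases hp.eq_or_lt with rfl | hp_pos
  · convert hasDecayRate_logNormal m hs le_rfl one_half_pos.le hrate
      (by simpa only [zero_add] using hlog_exp) (fun _ => measurableSet_Ioc)
      (fun _ => subset_rfl) (fun _ => Ioc_subset_Iic_self) using 1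
    rw [if_pos rfl]
    ring
  · have hexp : Tendsto (fun x : ℝ => Real.exp (-x / 2)) atTop (𝓝 0) :=
      Real.tendsto_exp_atBot.comp (tendsto_neg_atTop_atBot.atBot_div_const two_pos)
    have hlog : Tendsto (fun x : ℝ => Real.log (p + Real.exp (-x / 2)) / x) atTop (𝓝 (-0)) := by
      rw [neg_zero]
      exact ((hexp.const_add p).log (by simpa using hp_pos.ne')).div_atTop tendsto_id
    convert hasDecayRate_logNormal m hs hp le_rfl hrate hlog (fun _ => measurableSet_Ioc)
      (fun _ => subset_rfl) (fun _ => Ioc_subset_Iic_self) using 1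
    rw [if_neg hp_pos.ne']
    ring

end LogNormal

section Vector

theorem abs_dotProduct_le_mul_sum_abs {ι : Type*} [Fintype ι] {v w : ι → ℝ} {r : ℝ}
    (hv : ∀ j, |v j| ≤ r) : |v ⬝ᵥ w| ≤ r * ∑ j, |w j| := by
  rw [dotProduct, Finset.mul_sum]
  refine (Finset.abs_sum_le_sum_abs _ _).trans (Finset.sum_le_sum fun j _ => ?_)
  rw [abs_mul]
  gcongr
  exact hv j

variable {N : ℕ} {e v : Fin N → ℝ}

theorem IsUnipolar.abs_mul_le_abs_dotProduct (he : IsUnipolar e) (hv : ∀ j, 0 ≤ v j) (j : Fin N) :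
    |v j * e j| ≤ |v ⬝ᵥ e| := by
  have of_nonneg : ∀ {f : Fin N → ℝ}, (∀ k, 0 ≤ f k) → |v j * f j| ≤ |v ⬝ᵥ f| := by
    intro f hf
    have hterm : ∀ k, 0 ≤ v k * f k := fun k => mul_nonneg (hv k) (hf k)
    rw [abs_of_nonneg (hterm j), abs_of_nonneg (dotProduct_nonneg_of_nonneg hv hf)]
    exact Finset.single_le_sum (fun k _ => hterm k) (Finset.mem_univ j)
  rcases he with he | he
  · exact of_nonneg he
  · simpa using of_nonneg (f := -e) fun k => neg_nonneg.2 (he k)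

theorem exists_neg_pos_of_not_isUnipolar (he : ¬IsUnipolar e) : (∃ a, e a < 0) ∧ ∃ b, 0 < e b := by
  simpa only [IsUnipolar, not_or, not_forall, not_le] using he

theorem exists_pos_dotProduct_eq_zero (he : ¬IsUnipolar e) :
    ∃ p : Fin N → ℝ, (∀ j, 0 < p j) ∧ p ⬝ᵥ e = 0 := by
  obtain ⟨⟨a, ha⟩, b, hb⟩ := exists_neg_pos_of_not_isUnipolar he
  have single_nonneg : ∀ (i j : Fin N) {c : ℝ}, 0 ≤ c → 0 ≤ (Pi.single i c : Fin N → ℝ) j :=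
    fun i j _ hc => (Pi.single_nonneg (α := fun _ => ℝ)).2 hc j
  set S := ∑ j, e j
  refine ⟨1 + Pi.single a (S⁺ / -e a) + Pi.single b (S⁻ / e b), fun j => ?_, ?_⟩
  · have hSa := single_nonneg a j (div_nonneg (posPart_nonneg S) (neg_pos.2 ha).le)
    have hSb := single_nonneg b j (div_nonneg (negPart_nonneg S) hb.le)
    simp only [Pi.add_apply, Pi.one_apply]
    positivity
  · rw [add_dotProduct, add_dotProduct, one_dotProduct, single_dotProduct, single_dotProduct,
      div_neg, neg_mul, div_mul_cancel₀ _ ha.ne, div_mul_cancel₀ _ hb.ne']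
    linarith [posPart_sub_negPart S]

theorem forall_vecMulVec_self_pos_iff :
    (∀ i j, 0 < Matrix.vecMulVec e e i j) ↔ IsUnipolar e ∧ ∀ j, e j ≠ 0 := by
  simp only [Matrix.vecMulVec_apply]
  constructor
  · intro h
    refine ⟨?_, fun j => mul_self_pos.1 (h j j)⟩
    by_contra he
    obtain ⟨⟨a, ha⟩, b, hb⟩ := exists_neg_pos_of_not_isUnipolar he
    exact (mul_neg_of_neg_of_pos ha hb).not_gt (h a b)
  · rintro ⟨he | he, hne⟩ i j
    · exact mul_pos ((he i).lt_of_ne' (hne i)) ((he j).lt_of_ne' (hne j))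
    · exact mul_pos_of_neg_of_neg ((he i).lt_of_ne (hne i)) ((he j).lt_of_ne (hne j))

end Vector

section Channel

variable {M N : ℕ} {m σ : Fin M → Fin N → ℝ} {P ρ D : ℝ} {e p : Fin N → ℝ}

instance isProbabilityMeasure_channelLaw (m σ : Fin M → Fin N → ℝ) :
    IsProbabilityMeasure (channelLaw m σ) := by
  unfold channelLaw
  infer_instance

theorem ae_channelLaw_pos (m σ : Fin M → Fin N → ℝ) :
    ∀ᵐ h ∂channelLaw m σ, ∀ i j, 0 < h i j := by
  have hrow : ∀ i, ∀ᵐ r ∂Measure.pi fun j => logNormal (m i j) (σ i j), ∀ j, 0 < r j := fun i =>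
    eventually_all.2 fun j =>
      Measure.tendsto_eval_ae_ae.eventually (ae_logNormal_pos (m i j) (σ i j))
  exact eventually_all.2 fun i => (Measure.tendsto_eval_ae_ae
    (μ := fun i => Measure.pi fun j => logNormal (m i j) (σ i j))).eventually (hrow i)

/-- The set of the channel matrices all of whose rows lie in the box with sides `S j`. -/
def rowBox (M : ℕ) (S : Fin N → Set ℝ) : Set (Fin M → Fin N → ℝ) :=
  univ.pi fun _ => univ.pi S

theorem mem_rowBox {S : Fin N → Set ℝ} {h : Fin M → Fin N → ℝ} :
    h ∈ rowBox M S ↔ ∀ i j, h i j ∈ S j := by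
  simp only [rowBox, mem_univ_pi]

theorem measurableSet_rowBox {S : Fin N → Set ℝ} (hS : ∀ j, MeasurableSet (S j)) :
    MeasurableSet (rowBox M S) :=
  .univ_pi fun _ => .univ_pi hS

theorem hasDecayRate_channelLaw_rowBox {S : ℝ → Fin N → Set ℝ} {c : Fin M → Fin N → ℝ}
    (hS : ∀ i j, HasDecayRate (fun x => (logNormal (m i j) (σ i j)).real (S x j)) (c i j)) :
    HasDecayRate (fun x => (channelLaw m σ).real (rowBox M (S x))) (∑ i, ∑ j, c i j) := by
  simpa only [channelLaw, rowBox, Measure.real, Measure.pi_pi, ENNReal.toReal_prod] using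
    HasDecayRate.prod fun i _ => HasDecayRate.prod fun j _ => hS i j

theorem measurable_distance (P ρ : ℝ) (e : Fin N → ℝ) :
    Measurable (distance (M := M) P ρ e) := by
  unfold distance dotProduct
  fun_prop

theorem distance_le_of_abs_sub_le (hpe : p ⬝ᵥ e = 0) {r : ℝ} {h : Fin M → Fin N → ℝ}
    (hh : ∀ i j, |h i j - p j| ≤ r) (hρ : 0 ≤ ρ) :
    distance P ρ e h ≤ √(ρ / (N * P ^ 2) * (M * (r * ∑ j, |e j|) ^ 2)) := by
  have hrow : ∀ i, (h i ⬝ᵥ e) ^ 2 ≤ (r * ∑ j, |e j|) ^ 2 := fun i => by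
    rw [← sub_zero (h i ⬝ᵥ e), ← hpe, ← sub_dotProduct]
    exact sq_le_sq.2 ((abs_dotProduct_le_mul_sum_abs (hh i)).trans (le_abs_self _))
  refine Real.sqrt_le_sqrt ?_
  gcongr
  simpa using Finset.sum_le_card_nsmul Finset.univ _ _ fun i _ => hrow i

theorem IsUnipolar.sqrt_mul_sq_le_distance (he : IsUnipolar e) {h : Fin M → Fin N → ℝ}
    (hh : ∀ i j, 0 ≤ h i j) (hρ : 0 ≤ ρ) (i : Fin M) (j : Fin N) :
    √(ρ / (N * P ^ 2) * (h i j * e j) ^ 2) ≤ distance P ρ e h := by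
  refine Real.sqrt_le_sqrt ?_
  gcongr
  exact (sq_le_sq.2 (he.abs_mul_le_abs_dotProduct (hh i) j)).trans
    (Finset.single_le_sum (f := fun i => (h i ⬝ᵥ e) ^ 2) (fun _ _ => sq_nonneg _)
      (Finset.mem_univ i))

theorem integrable_gaussianQ_distance (m σ : Fin M → Fin N → ℝ) (P ρ : ℝ) (e : Fin N → ℝ) :
    Integrable (fun h => gaussianQ (distance P ρ e h / 2)) (channelLaw m σ) := by
  refine .of_bound (C := 1) ?_ (ae_of_all _ fun h => ?_)
  · exact (gaussianQ_antitone.measurable.comp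
      ((measurable_distance P ρ e).div_const 2)).aestronglyMeasurable
  · rw [Real.norm_of_nonneg (gaussianQ_pos _).le]
    exact gaussianQ_le_one _

theorem pep_le_one (m σ : Fin M → Fin N → ℝ) (P : ℝ) (e : Fin N → ℝ) (ρ : ℝ) :
    pep m σ P e ρ ≤ 1 := by
  simpa [pep] using integral_mono (integrable_gaussianQ_distance m σ P ρ e) (integrable_const 1)
    fun _ => gaussianQ_le_one _

theorem gaussianQ_mul_le_pep {S : Set (Fin M → Fin N → ℝ)} (hS : MeasurableSet S)
    (hD : ∀ h ∈ S, distance P ρ e h ≤ D) :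
    gaussianQ (D / 2) * (channelLaw m σ).real S ≤ pep m σ P e ρ := by
  have hint := integrable_gaussianQ_distance m σ P ρ e
  calc gaussianQ (D / 2) * (channelLaw m σ).real S
      = ∫ _ in S, gaussianQ (D / 2) ∂channelLaw m σ := by simp [mul_comm]
    _ ≤ ∫ h in S, gaussianQ (distance P ρ e h / 2) ∂channelLaw m σ :=
        setIntegral_mono_on (integrableOn_const (by simp)) hint.integrableOn hS fun h hh =>
          gaussianQ_antitone (div_le_div_of_nonneg_right (hD h hh) zero_le_two)
    _ ≤ pep m σ P e ρ :=
        setIntegral_le_integral hint (ae_of_all _ fun _ => (gaussianQ_pos _).le)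

theorem pep_le_add_exp {S : Set (Fin M → Fin N → ℝ)} (hS : MeasurableSet S) (hD0 : 0 ≤ D)
    (hD : ∀ᵐ h ∂channelLaw m σ, h ∉ S → D ≤ distance P ρ e h) :
    pep m σ P e ρ ≤ (channelLaw m σ).real S + Real.exp (-(D ^ 2 / 8)) := by
  have hbound : ∀ᵐ h ∂channelLaw m σ, gaussianQ (distance P ρ e h / 2) ≤
      S.indicator 1 h + Real.exp (-(D ^ 2 / 8)) := by
    filter_upwards [hD] with h hh
    by_cases hhS : h ∈ S
    · rw [indicator_of_mem hhS]
      exact (gaussianQ_le_one _).trans (le_add_of_nonneg_right (Real.exp_pos _).le)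
    · rw [indicator_of_notMem hhS, zero_add]
      calc gaussianQ (distance P ρ e h / 2)
          ≤ gaussianQ (D / 2) :=
            gaussianQ_antitone (div_le_div_of_nonneg_right (hh hhS) zero_le_two)
        _ ≤ Real.exp (-((D / 2) ^ 2 / 2)) := gaussianQ_le (by positivity)
        _ = Real.exp (-(D ^ 2 / 8)) := by ring_nf
  have hind : Integrable (S.indicator (1 : (Fin M → Fin N → ℝ) → ℝ)) (channelLaw m σ) :=
    (integrable_const (1 : ℝ)).indicator hS
  refine (integral_mono_ae (integrable_gaussianQ_distance m σ P ρ e)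
    (hind.add (integrable_const _)) hbound).trans_eq ?_
  simp only [Pi.add_apply]
  rw [integral_add hind (integrable_const _), integral_indicator_one hS]
  simp

end Channel

section DiversityGain

variable {M N : ℕ} {σ : Fin M → Fin N → ℝ} {P : ℝ} {e p : Fin N → ℝ}

theorem exp_mul_exp_neg_half_sq (x : ℝ) : Real.exp x * Real.exp (-x / 2) ^ 2 = 1 := by
  rw [← Real.exp_nat_mul, ← Real.exp_add, Real.exp_eq_one_iff]
  push_cast
  ring

theorem exists_gaussianQ_mul_rowBox_le_pep (m σ : Fin M → Fin N → ℝ) (P : ℝ)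
    (hpe : p ⬝ᵥ e = 0) :
    ∃ q : ℝ, 0 < q ∧ ∀ x, q * (channelLaw m σ).real
      (rowBox M fun j => Ioc (p j) (p j + Real.exp (-x / 2))) ≤ pep m σ P e (Real.exp x) := by
  refine ⟨_, gaussianQ_pos (√(1 / (N * P ^ 2) * (M * (∑ j, |e j|) ^ 2)) / 2), fun x =>
    gaussianQ_mul_le_pep (measurableSet_rowBox fun _ => measurableSet_Ioc) fun h hh => ?_⟩
  have hnear : ∀ i j, |h i j - p j| ≤ Real.exp (-x / 2) := fun i j => by
    obtain ⟨hlt, hle⟩ := mem_rowBox.1 hh i j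
    rw [abs_of_pos (sub_pos.2 hlt)]
    exact sub_le_iff_le_add'.2 hle
  refine (distance_le_of_abs_sub_le hpe hnear (Real.exp_pos x).le).trans_eq ?_
  congr 1
  linear_combination M * (∑ j, |e j|) ^ 2 / (N * P ^ 2) * exp_mul_exp_neg_half_sq x

theorem exists_hasDecayRate_le_pep (m : Fin M → Fin N → ℝ) (hσ : ∀ i j, σ i j ≠ 0) (P : ℝ)
    (hp : ∀ j, 0 ≤ p j) (hpe : p ⬝ᵥ e = 0) :
    ∃ f : ℝ → ℝ, HasDecayRate f ((∑ i, ∑ j with p j = 0, (σ i j ^ 2)⁻¹) / 8) ∧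
      ∀ x, f x ≤ pep m σ P e (Real.exp x) := by
  obtain ⟨q, hq, hle⟩ := exists_gaussianQ_mul_rowBox_le_pep m σ P hpe
  refine ⟨_, ?_, hle⟩
  have hbox := hasDecayRate_channelLaw_rowBox fun i j =>
    hasDecayRate_logNormal_Ioc (m i j) (hσ i j) (hp j)
  simpa only [zero_add, ← Finset.sum_filter, ← Finset.sum_div] using
    (hasDecayRate_const hq).mul hbox

theorem exists_pos_forall_le_of_ne_zero (hP : P ≠ 0) (e : Fin N → ℝ) :
    ∃ κ > 0, ∀ j, e j ≠ 0 → κ ≤ e j ^ 2 / (N * P ^ 2) := by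
  have hsmall : ∀ᶠ κ : ℝ in 𝓝[>] 0, ∀ j, e j ≠ 0 → κ ≤ e j ^ 2 / (N * P ^ 2) := by
    refine eventually_all.2 fun j => eventually_imp_distrib_left.2 fun hj => ?_
    have : 0 < N := j.pos
    exact nhdsWithin_le_nhds (eventually_le_nhds (by positivity))
  exact (eventually_mem_nhdsWithin.and hsmall).exists

-- The factor `x ^ 2` in the sides leaves the decay rate of the box unchanged, but makes the
-- contribution of its complement negligible.
theorem IsUnipolar.exists_pep_le_rowBox_add_exp (he : IsUnipolar e) (m σ : Fin M → Fin N → ℝ)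
    (hP : P ≠ 0) :
    ∃ κ > 0, ∀ x, pep m σ P e (Real.exp x) ≤ (channelLaw m σ).real (rowBox M fun j =>
      if e j = 0 then univ else Iic (x ^ 2 * Real.exp (-x / 2))) +
        Real.exp (-(κ * x ^ 4 / 8)) := by
  obtain ⟨κ, hκ, hκe⟩ := exists_pos_forall_le_of_ne_zero hP e
  refine ⟨κ, hκ, fun x => ?_⟩
  have hmeas : ∀ j, MeasurableSet
      (if e j = 0 then univ else Iic (x ^ 2 * Real.exp (-x / 2)) : Set ℝ) := fun j => by
    split_ifs <;> measurability
  have hpep := pep_le_add_exp (m := m) (σ := σ) (P := P) (ρ := Real.exp x) (e := e)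
    (measurableSet_rowBox hmeas) (Real.sqrt_nonneg (κ * x ^ 4)) ?_
  · rwa [Real.sq_sqrt (by positivity)] at hpep
  filter_upwards [ae_channelLaw_pos m σ] with h hpos hh
  simp only [mem_rowBox, not_forall] at hh
  obtain ⟨i, j, hij⟩ := hh
  have hej : e j ≠ 0 := fun h0 => hij (by rw [if_pos h0]; trivial)
  rw [if_neg hej, mem_Iic, not_le] at hij
  refine le_trans (Real.sqrt_le_sqrt ?_)
    (he.sqrt_mul_sq_le_distance (fun i j => (hpos i j).le) (Real.exp_pos x).le i j)
  calc κ * x ^ 4 ≤ e j ^ 2 / (N * P ^ 2) * x ^ 4 := by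
        gcongr
        exact hκe j hej
    _ = Real.exp x / (N * P ^ 2) * (x ^ 2 * Real.exp (-x / 2) * e j) ^ 2 := by
        linear_combination -(e j ^ 2 / (N * P ^ 2) * x ^ 4) * exp_mul_exp_neg_half_sq x
    _ ≤ Real.exp x / (N * P ^ 2) * (h i j * e j) ^ 2 := by
        simp only [mul_pow _ (e j)]
        gcongr

theorem IsUnipolar.exists_pep_le_hasDecayRate (he : IsUnipolar e) (m : Fin M → Fin N → ℝ)
    (hσ : ∀ i j, σ i j ≠ 0) (hP : P ≠ 0) :
    ∃ f : ℝ → ℝ, HasDecayRate f ((∑ i, ∑ j with e j ≠ 0, (σ i j ^ 2)⁻¹) / 8) ∧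
      ∀ x, pep m σ P e (Real.exp x) ≤ f x := by
  obtain ⟨κ, hκ, hle⟩ := he.exists_pep_le_rowBox_add_exp m σ hP
  refine ⟨_, HasDecayRate.add_exp_neg ?_ ?_, hle⟩
  · have hside : ∀ i j, HasDecayRate (fun x => (logNormal (m i j) (σ i j)).real
        (if e j = 0 then univ else Iic (x ^ 2 * Real.exp (-x / 2))))
        (if e j ≠ 0 then (σ i j ^ 2)⁻¹ / 8 else 0) := fun i j => by
      by_cases hj : e j = 0
      · simpa [hj] using hasDecayRate_const one_pos
      · simpa [hj] using hasDecayRate_logNormal_Iic (m i j) (hσ i j)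
    simpa only [← Finset.sum_filter, ← Finset.sum_div] using
      hasDecayRate_channelLaw_rowBox hside
  · refine ((tendsto_pow_atTop two_ne_zero).const_mul_atTop (by positivity : 0 < κ / 8)).congr' ?_
    filter_upwards [eventually_gt_atTop 0] with x hx
    field

theorem IsUnipolar.hasLargeScaleDiversityGain_pep (he : IsUnipolar e) (m : Fin M → Fin N → ℝ)
    (hσ : ∀ i j, σ i j ≠ 0) (hP : P ≠ 0) :
    HasLargeScaleDiversityGain (pep m σ P e) (∑ i, ∑ j with e j ≠ 0, (σ i j ^ 2)⁻¹) := by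
  obtain ⟨u, hu, hle_u⟩ := he.exists_pep_le_hasDecayRate m hσ hP
  obtain ⟨l, hl, hl_le⟩ := exists_hasDecayRate_le_pep m hσ P (e := e)
    (p := fun j => if e j = 0 then 1 else 0) (fun j => by split_ifs <;> norm_num)
    (Finset.sum_eq_zero fun j _ => by simp)
  simp only [ite_eq_right_iff, one_ne_zero, imp_false] at hl
  exact (hl.squeeze hu (.of_forall hl_le) (.of_forall hle_u)).hasLargeScaleDiversityGain

theorem hasLargeScaleDiversityGain_pep_zero_of_not_isUnipolar (he : ¬IsUnipolar e)
    (m : Fin M → Fin N → ℝ) (hσ : ∀ i j, σ i j ≠ 0) (P : ℝ) :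
    HasLargeScaleDiversityGain (pep m σ P e) 0 := by
  obtain ⟨p, hp, hpe⟩ := exists_pos_dotProduct_eq_zero he
  obtain ⟨l, hl, hl_le⟩ := exists_hasDecayRate_le_pep m hσ P (fun j => (hp j).le) hpe
  simp only [(hp _).ne', Finset.filter_false, Finset.sum_empty, Finset.sum_const_zero,
    zero_div] at hl
  refine HasDecayRate.hasLargeScaleDiversityGain ?_
  rw [zero_div]
  exact hl.squeeze (hasDecayRate_const one_pos) (.of_forall hl_le)
    (.of_forall fun _ => pep_le_one m σ P e _)

theorem fullGain_pos (hM : 0 < M) (hN : 0 < N) (hσ : ∀ i j, σ i j ≠ 0) : 0 < fullGain σ := by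
  have : Nonempty (Fin M) := ⟨⟨0, hM⟩⟩
  have : Nonempty (Fin N) := ⟨⟨0, hN⟩⟩
  exact Finset.sum_pos (fun i _ => Finset.sum_pos
    (fun j _ => inv_pos.2 (sq_pos_of_ne_zero (hσ i j))) Finset.univ_nonempty) Finset.univ_nonempty

theorem sum_filter_ne_zero_eq_fullGain_iff (hM : 0 < M) (hσ : ∀ i j, σ i j ≠ 0) :
    ∑ i, ∑ j with e j ≠ 0, (σ i j ^ 2)⁻¹ = fullGain σ ↔ ∀ j, e j ≠ 0 := by
  have hpos : ∀ i j, 0 < (σ i j ^ 2)⁻¹ := fun i j => inv_pos.2 (sq_pos_of_ne_zero (hσ i j))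
  refine ⟨fun heq j hj => ?_, fun hne => by simp [fullGain, hne]⟩
  refine heq.not_lt (Finset.sum_lt_sum_of_nonempty ⟨⟨0, hM⟩, Finset.mem_univ _⟩ fun i _ => ?_)
  exact Finset.sum_lt_sum_of_subset (Finset.filter_subset _ _) (Finset.mem_univ j) (by simp [hj])
    (hpos i j) fun k _ _ => (hpos i k).le

theorem hasLargeScaleDiversityGain_fullGain_iff (hM : 0 < M) (m : Fin M → Fin N → ℝ)
    (hσ : ∀ i j, σ i j ≠ 0) (hP : P ≠ 0) :
    HasLargeScaleDiversityGain (pep m σ P e) (fullGain σ) ↔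
      IsUnipolar e ∧ ∀ j, e j ≠ 0 := by
  by_cases he : IsUnipolar e
  · have hgain := he.hasLargeScaleDiversityGain_pep m hσ hP
    rw [← sum_filter_ne_zero_eq_fullGain_iff hM hσ]
    exact ⟨fun h => ⟨he, tendsto_nhds_unique hgain h⟩, fun h => h.2 ▸ hgain⟩
  · refine ⟨fun h => ?_, fun h => absurd h.1 he⟩
    obtain ⟨⟨a, -⟩, -⟩ := exists_neg_pos_of_not_isUnipolar he
    exact absurd
      (tendsto_nhds_unique (hasLargeScaleDiversityGain_pep_zero_of_not_isUnipolar he m hσ P) h)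
      (fullGain_pos hM a.pos hσ).ne

end DiversityGain

end MimoOwc

theorem theorem2 {M N L : ℕ} (hM : 0 < M) (m σ : Fin M → Fin N → ℝ) (hσ : ∀ i j, 0 < σ i j)
    (C : MimoOwc.SpaceCode L N) (hP : 0 < C.opticalPower) :
    (MimoOwc.EnablesFullLargeScaleDiversity m σ C ↔
      ∀ e ∈ C.errorSet, MimoOwc.IsUnipolar e ∧ ∀ j, e j ≠ 0) ∧
    (MimoOwc.EnablesFullLargeScaleDiversity m σ C ↔
      ∀ e ∈ C.errorSet, ∀ i j, 0 < Matrix.vecMulVec e e i j) := by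
  have h : MimoOwc.EnablesFullLargeScaleDiversity m σ C ↔
      ∀ e ∈ C.errorSet, MimoOwc.IsUnipolar e ∧ ∀ j, e j ≠ 0 :=
    forall₂_congr fun _ _ =>
      MimoOwc.hasLargeScaleDiversityGain_fullGain_iff hM m (fun i j => (hσ i j).ne') hP.ne'
  exact ⟨h, h.trans (forall₂_congr fun _ _ => MimoOwc.forall_vecMulVec_self_pos_iff.symm)⟩
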